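/- **Theorem 4.1.** Let $(M,g)$ be an $n$-dimensional (Hausdorff) smooth Riemannian manifold, $k,p\in\mathbb N$ with $k>0$, $p>1$, $k+p<n-1$, and put $r=n-(k+p)$. Let $U\subseteq M$ be open, and let $I_1,\dots,I_k,D_1,\dots,D_p,h_1,\dots,h_p\in C^\infty(U,\mathbb R)$ be such that the gradients $\nabla_g I_1,\dots,\nabla_g I_k,\nabla_g D_1,\dots,\nabla_g D_p$ are linearly independent at every point of $U$. Write $\mathfrak X(U)$ for the smooth vector fields on $U$, $\mathcal L_Xf=df(X)$, and $$\mathfrak X[\nabla_g I,\nabla_g D]=\{X\in\mathfrak X(U): g(X,\nabla_g I_l)=g(X,\nabla_g D_j)=0,\ 1\le l\le k,\ 1\le j\le p\}.$$ The exterior power $\Lambda^qT_xM$ carries the inner product with $\langle v_1\wedge\dots\wedge v_q,w_1\wedge\dots\wedge w_q\rangle_q=\det[g(v_i,w_j)]$ and its norm $\|\cdot\|_q$. For a unit $n$-vector $\mu=e_1\wedge\dots\wedge e_n$ ($e$ an orthonormal basis of $T_xM$, so $\mu$ is an orientation of $T_xM$), the Hodge star $\star:\Lambda^qT_xM\to\Lambda^{n-q}T_xM$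 is determined by $\langle\star\nu,\eta\rangle_{n-q}\,\mu=\nu\wedge\eta$ for all $\eta\in\Lambda^{n-q}T_xM$. Wedge products over an index set are taken in increasing order of the index. Put $$X_0=\Big\|\bigwedge_{j=1}^p\nabla_gD_j\wedge\bigwedge_{l=1}^k\nabla_gI_l\Big\|_{k+p}^{-2}\sum_{i=1}^p(-1)^{n-i}h_i\Theta_i,\qquad \Theta_i=\star\Big[\bigwedge_{j\ne i}\nabla_gD_j\wedge\bigwedge_{l=1}^k\nabla_gI_l\wedge\star\Big(\bigwedge_{j=1}^p\nabla_gD_j\wedge\bigwedge_{l=1}^k\nabla_gI_l\Big)\Big],$$ where the stars at each $x\in U$ are taken with respect to one arbitrarily chosen unit $n$-vector of $T_xM$. Then $X_0\in\mathfrak X(U)$, and the set $\mathfrak A$ of solutions $X\in\mathfrak X(U)$ of $$\mathcal L_XI_1=\dots=\mathcal L_XI_k=0,\qquad \mathcal L_XD_1=h_1,\dots,\mathcal L_XD_p=h_p$$ is $X_0+\mathfrak X[\nabla_g I,\nabla_g D]$. It consists of dissipative vector fields, that is, fields $X\in\mathfrak X(U)$ for which there are $k',p'\in\mathbb N$ with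 $k'+p'>0$ and functions $I'_1,\dots,I'_{k'},D'_1,\dots,D'_{p'},h'_1,\dots,h'_{p'}\in C^\infty(U,\mathbb R)$ such that $\mathcal L_XI'_l=0$ and $\mathcal L_XD'_j=h'_j$ for all $l$ and $j$. Moreover, $\mathfrak A$ is an $r$-dimensional smooth affine distribution on $U$: around each point of $U$ there is a set of local generators of $\mathfrak A$, and $\mathfrak A$ is the set of all $X\in\mathfrak X(U)$ with $X(x)\in\mathfrak A_x:=\{Y(x):Y\in\mathfrak A\}$ for every $x\in U$. Here a set of local generators of $\mathfrak A$ on an open $V\subseteq U$ is $\{W_0\}\uplus\{W_1,\dots,W_r\}\subset\mathfrak X(V)$ with $W_1,\dots,W_r$ pointwise linearly independent and $\mathfrak A_{x}=W_0(x)+\operatorname{span}\{W_1(x),\dots,W_r(x)\}$ for all $x\in V$. Explicitly, every $x\in U$ has an open neighborhood $V\subseteq U$ with an orientation (a smooth field of unit $n$-vectors) on which there are $Z_1,\dots,Z_r\in\mathfrak X(V)$ such that $\{\nabla_gI_1,\dots,\nabla_gI_k,\nabla_gD_1,\dots,\nabla_gD_p,Z_1,\dots,Z_r\}$ is a moving frame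 on $V$ (a basis of the tangent space at each point of $V$); and for every open $V\subseteq U$, every orientation of $V$ and every such $Z_1,\dots,Z_r$, $$\{X_0\}\uplus\Big\{\star\Big(\bigwedge_{i\ne a}Z_i\wedge\bigwedge_{j=1}^p\nabla_gD_j\wedge\bigwedge_{l=1}^k\nabla_gI_l\Big): a=1,\dots,r\Big\}$$ is a set of local generators of $\mathfrak A$ on $V$, the stars being taken with respect to the orientation of $V$. -/

import Mathlib

open Manifold Bundle Topology
open scoped ContDiff

noncomputable section

/-! ### Exterior powers of an inner product space -/

section Linear

variable {E : Type*} [NormedAddCommGroup E] [InnerProductSpace ℝ E]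

/-- The `m`-vector `v₀ ∧ ⋯ ∧ v_{m-1}`. -/
def wedgeAll {m : ℕ} (v : Fin m → E) : ⋀[ℝ]^m E :=
  exteriorPower.ιMulti ℝ m v

/-- The `(m-1)`-vector `v₀ ∧ ⋯ ∧ v_{m-1}` with the factor `v_a` omitted (order preserved). -/
def wedgeOmit {m : ℕ} (v : Fin m → E) (a : Fin m) : ⋀[ℝ]^(m - 1) E :=
  exteriorPower.ιMulti ℝ (m - 1) fun j : Fin (m - 1) =>
    v ⟨if (j : ℕ) < a then j else j + 1, by split_ifs <;> omega⟩

/-- The wedge product of a `p`-vector and a `q`-vector, as a `(p+q)`-vector. -/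
def wedgeMul {p q : ℕ} (x : ⋀[ℝ]^p E) (y : ⋀[ℝ]^q E) : ⋀[ℝ]^(p + q) E :=
  ⟨(x : ExteriorAlgebra ℝ E) * y, SetLike.mul_mem_graded x.2 y.2⟩

infixl:70 " ⋏ " => wedgeMul

/-- The inner product on `Λᵖ E` induced by the one of `E`. -/
def innerPow (p : ℕ) : ⋀[ℝ]^p E →ₗ[ℝ] ⋀[ℝ]^p E →ₗ[ℝ] ℝ :=
  exteriorPower.pairingDual ℝ E p ∘ₗ exteriorPower.map p (innerₗ E)

/-- On decomposable `p`-vectors the inner product is the determinant of inner products. -/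
theorem innerPow_wedgeAll {p : ℕ} (v w : Fin p → E) :
    innerPow p (wedgeAll v) (wedgeAll w)
      = (Matrix.of fun i j => inner ℝ (v i) (w j)).det := by
  rw [← Matrix.det_transpose]
  simp only [innerPow, wedgeAll, LinearMap.comp_apply, exteriorPower.map_apply_ιMulti,
    exteriorPower.pairingDual_ιMulti_ιMulti]
  rfl

/-- The norm on `Λᵖ E`. -/
def normPow {p : ℕ} (x : ⋀[ℝ]^p E) : ℝ := √(innerPow p x x)

/-- `μ = e₁ ∧ ⋯ ∧ eₙ` for some orthonormal family of `n` vectors; for `n = dim E` these are the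
two unit `n`-vectors, that is, the two orientations of `E`. -/
def IsUnitVolume {n : ℕ} (μ : ⋀[ℝ]^n E) : Prop :=
  ∃ e : Fin n → E, Orthonormal ℝ e ∧ μ = wedgeAll e

/-- `σ ∈ Λ^q E` is a Hodge dual of `ν ∈ Λ^p E` with respect to `μ`:
`⟨σ, η⟩ μ = ν ∧ η` for all `η ∈ Λ^q E`. -/
def IsHodgeDual {n p q : ℕ} (μ : ⋀[ℝ]^n E) (ν : ⋀[ℝ]^p E) (σ : ⋀[ℝ]^q E) : Prop :=
  ∀ η : ⋀[ℝ]^q E, innerPow q σ η • (μ : ExteriorAlgebra ℝ E) = (ν ⋏ η : ⋀[ℝ]^(p + q) E)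

/-- The Hodge star `⋆ν ∈ Λ^q E` of `ν ∈ Λ^p E`, where `p + q = n = dim E`; it is the element
characterized in `isHodgeDual_iff_eq_hodgeStar`. -/
def hodgeStar {n p : ℕ} (μ : ⋀[ℝ]^n E) (q : ℕ) (ν : ⋀[ℝ]^p E) : ⋀[ℝ]^q E :=
  Classical.epsilon fun σ : ⋀[ℝ]^q E => IsHodgeDual μ ν σ

theorem innerPow_basis {n : ℕ} (e : OrthonormalBasis (Fin n) ℝ E) {q : ℕ}
    (s : Set.powersetCard (Fin n) q) :
    innerPow q (e.toBasis.exteriorPower q s) = (e.toBasis.exteriorPower q).coord s := by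
  have h : ⇑(innerₗ E) ∘ ⇑e.toBasis = e.toBasis.coord := by
    funext i
    ext v
    simp [OrthonormalBasis.repr_apply_apply]
  rw [exteriorPower.basis_coord, exteriorPower.basis_apply, innerPow, LinearMap.comp_apply,
    exteriorPower.map_apply_ιMulti_family, h]
  rfl

/-- A unit `n`-vector of an `n`-dimensional space spans the line of `n`-vectors. -/
theorem exists_smul_unitVolume [FiniteDimensional ℝ E] {n : ℕ} (hn : Module.finrank ℝ E = n) {μ : ⋀[ℝ]^n E}
    (hμ : IsUnitVolume μ) :
    ∃ c : ⋀[ℝ]^n E →ₗ[ℝ] ℝ, μ ≠ 0 ∧ ∀ x, c x • μ = x := by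
  obtain ⟨e, he, rfl⟩ := hμ
  have h1 : innerPow n (wedgeAll e) (wedgeAll e) = 1 := by
    rw [innerPow_wedgeAll]
    have : (Matrix.of fun i j => inner ℝ (e i) (e j)) = (1 : Matrix (Fin n) (Fin n) ℝ) := by
      ext i j
      simp [Matrix.one_apply, orthonormal_iff_ite.mp he i j]
    rw [this, Matrix.det_one]
  have h0 : wedgeAll e ≠ 0 := by
    intro h
    rw [h] at h1
    simp at h1
  refine ⟨innerPow n (wedgeAll e), h0, fun x => ?_⟩
  obtain ⟨c, rfl⟩ : ∃ c : ℝ, c • wedgeAll e = x := by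
    have hf : Module.finrank ℝ (⋀[ℝ]^n E) = 1 := by
      rw [exteriorPower.finrank_eq, hn, Nat.choose_self]
    exact (finrank_eq_one_iff_of_nonzero' _ h0).mp hf x
  simp [h1]

/-- Existence and uniqueness of the Hodge star. -/
theorem isHodgeDual_iff_eq_hodgeStar [FiniteDimensional ℝ E] {n p q : ℕ}
    (hn : Module.finrank ℝ E = n) (hpq : p + q = n)
    {μ : ⋀[ℝ]^n E} (hμ : IsUnitVolume μ) (ν : ⋀[ℝ]^p E) (σ : ⋀[ℝ]^q E) :
    IsHodgeDual μ ν σ ↔ σ = hodgeStar μ q ν := by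
  subst hpq
  obtain ⟨c, hμ0, hc⟩ := exists_smul_unitVolume hn hμ
  let e : OrthonormalBasis (Fin (p + q)) ℝ E := (stdOrthonormalBasis ℝ E).reindex (finCongr hn)
  let b := e.toBasis.exteriorPower q
  let L : ⋀[ℝ]^q E →ₗ[ℝ] ⋀[ℝ]^(p + q) E :=
    { toFun := fun η => ν ⋏ η
      map_add' := fun x y => Subtype.ext (mul_add _ _ _)
      map_smul' := fun r x => Subtype.ext (mul_smul_comm _ _ _) }
  have key : ∀ τ : ⋀[ℝ]^q E, IsHodgeDual μ ν τ ↔ innerPow q τ = c ∘ₗ L := by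
    intro τ
    rw [LinearMap.ext_iff]
    refine forall_congr' fun η => ?_
    have h2 : ((ν ⋏ η : ⋀[ℝ]^(p + q) E) : ExteriorAlgebra ℝ E)
        = c (ν ⋏ η) • (μ : ExteriorAlgebra ℝ E) :=
      congrArg Subtype.val (hc (ν ⋏ η)).symm
    have h3 : (μ : ExteriorAlgebra ℝ E) ≠ 0 := fun h => hμ0 (Subtype.ext h)
    rw [h2]
    exact smul_left_inj h3
  have hex : innerPow q (∑ s, (c ∘ₗ L) (b s) • b s) = c ∘ₗ L := by
    refine b.ext fun t => ?_
    simp only [map_sum, map_smul, LinearMap.sum_apply, LinearMap.smul_apply]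
    simp only [b, innerPow_basis, Module.Basis.coord_apply, Module.Basis.repr_self]
    simp [Finsupp.single_apply]
  have hinj : ∀ σ τ : ⋀[ℝ]^q E, innerPow q σ = innerPow q τ → σ = τ := by
    have h4 : ∀ x : ⋀[ℝ]^q E, innerPow q x = 0 → x = 0 := by
      intro x hx
      refine b.ext_elem fun t => ?_
      have h5 : innerPow q x (b t) = b.repr x t := by
        conv_lhs => rw [← b.sum_repr x]
        simp only [map_sum, map_smul, LinearMap.sum_apply, LinearMap.smul_apply]
        simp only [b, innerPow_basis, Module.Basis.coord_apply, Module.Basis.repr_self]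
        simp [Finsupp.single_apply]
      rw [← h5, hx]
      simp
    intro σ τ h
    exact sub_eq_zero.mp (h4 _ (by rw [map_sub, h, sub_self]))
  have hs : IsHodgeDual μ ν (hodgeStar μ q ν) :=
    Classical.epsilon_spec (p := fun σ : ⋀[ℝ]^q E => IsHodgeDual μ ν σ) ⟨_, (key _).mpr hex⟩
  refine ⟨fun h => hinj _ _ ?_, fun h => h ▸ hs⟩
  rw [(key _).mp h, (key _).mp hs]

end Linear

/-! ### Vector fields on open subsets of a Riemannian manifold

The metric is given by the inner products on the tangent spaces. Functions and vector fields on an open set `U` are represented by functions and vector fields on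
`M` whose values outside `U` are irrelevant. -/

section Riemannian

variable {n : ℕ} {M : Type*} [TopologicalSpace M] [ChartedSpace (EuclideanSpace ℝ (Fin n)) M]

/-- Vector fields on `M`, without any regularity. -/
abbrev VField (n : ℕ) (M : Type*) [TopologicalSpace M]
    [ChartedSpace (EuclideanSpace ℝ (Fin n)) M] : Type _ :=
  (x : M) → TangentSpace (𝓡 n) x

section Gradient

variable [RiemannianBundle (fun x : M => TangentSpace (𝓡 n) x)]

/-- The gradient of `f`: `⟨∇f(x), v⟩ = df_x(v)` for all `v`. -/
def grad (f : M → ℝ) : VField n M := fun x =>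
  haveI : FiniteDimensional ℝ (TangentSpace (𝓡 n) x) :=
    inferInstanceAs (FiniteDimensional ℝ (EuclideanSpace ℝ (Fin n)))
  haveI : CompleteSpace (TangentSpace (𝓡 n) x) := FiniteDimensional.complete ℝ _
  (InnerProductSpace.toDual ℝ (TangentSpace (𝓡 n) x)).symm
    (mfderiv (𝓡 n) 𝓘(ℝ, ℝ) f x : TangentSpace (𝓡 n) x →L[ℝ] ℝ)

/-- Defining property of the gradient. -/
theorem inner_grad (f : M → ℝ) (x : M) (v : TangentSpace (𝓡 n) x) :
    inner ℝ (grad f x) v = mfderiv (𝓡 n) 𝓘(ℝ, ℝ) f x v := by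
  have : FiniteDimensional ℝ (TangentSpace (𝓡 n) x) :=
    inferInstanceAs (FiniteDimensional ℝ (EuclideanSpace ℝ (Fin n)))
  have : CompleteSpace (TangentSpace (𝓡 n) x) := FiniteDimensional.complete ℝ _
  exact InnerProductSpace.toDual_symm_apply

end Gradient

variable [IsManifold (𝓡 n) ∞ M]

/-- `𝔛(U)`: the vector fields that are smooth on `U`. -/
def smoothFields (U : Set M) : Set (VField n M) :=
  {X | ContMDiffOn (𝓡 n) (𝓡 n).tangent ∞ (fun x => (⟨x, X x⟩ : TangentBundle (𝓡 n) M)) U}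

/-- The Lie derivative `(L_X f)(x) = df_x (X x)` of a function. -/
def lieDeriv (X : VField n M) (f : M → ℝ) (x : M) : ℝ :=
  mfderiv (𝓡 n) 𝓘(ℝ, ℝ) f x (X x)

/-- `X` conserves `F` on `U`. -/
def Conserves (U : Set M) (X : VField n M) (F : M → ℝ) : Prop :=
  ∀ x ∈ U, lieDeriv X F x = 0

/-- `X` dissipates `H` on `U` with dissipation rate `h`. -/
def Dissipates (U : Set M) (X : VField n M) (H h : M → ℝ) : Prop :=
  ∀ x ∈ U, lieDeriv X H x = h x

/-- Smooth real functions on `U`. -/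
def IsSmoothFun (U : Set M) (f : M → ℝ) : Prop :=
  ContMDiffOn (𝓡 n) 𝓘(ℝ, ℝ) ∞ f U

/-- Dissipative vector fields on `U`. -/
def IsDissipative (U : Set M) (X : VField n M) : Prop :=
  X ∈ smoothFields U ∧ ∃ (k p : ℕ) (I : Fin k → M → ℝ) (D h : Fin p → M → ℝ), 0 < k + p ∧
    (∀ l, IsSmoothFun (n := n) U (I l)) ∧ (∀ j, IsSmoothFun (n := n) U (D j)) ∧
    (∀ j, IsSmoothFun (n := n) U (h j)) ∧
    (∀ l, Conserves U X (I l)) ∧ ∀ j, Dissipates U X (D j) (h j)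

/-- `F` is a moving frame on `V`: smooth vector fields that form a basis of each tangent space. -/
def IsMovingFrame {ι : Type*} (V : Set M) (F : ι → VField n M) : Prop :=
  (∀ i, F i ∈ smoothFields V) ∧
    ∀ x ∈ V, LinearIndependent ℝ (fun i => F i x) ∧ Submodule.span ℝ (Set.range fun i => F i x) = ⊤

/-- `𝒜_x`, the set of values at `x` of a set `𝒜` of vector fields. -/
def fiberAt (𝒜 : Set (VField n M)) (x : M) : Set (TangentSpace (𝓡 n) x) :=
  (fun X => X x) '' 𝒜

/-- `{X₀} ⊎ {G₁, …, G_r}` is a set of local generators, on the open set `V`, of `𝒜`. -/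
def IsLocalGenerators {r : ℕ} (𝒜 : Set (VField n M)) (V : Set M) (X₀ : VField n M)
    (G : Fin r → VField n M) : Prop :=
  X₀ ∈ smoothFields V ∧ (∀ a, G a ∈ smoothFields V) ∧
    ∀ x ∈ V, LinearIndependent ℝ (fun a => G a x) ∧
      fiberAt 𝒜 x = {v | ∃ w ∈ Submodule.span ℝ (Set.range fun a => G a x), v = X₀ x + w}

/-- `𝒜 ⊆ 𝔛(U)` is a smooth `r`-dimensional affine distribution on `U`: it has local generators
around each point of `U`, and it consists of all smooth vector fields on `U` with values in
the affine subspaces `𝒜_x`. -/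
def IsSmoothAffineDistribution (r : ℕ) (U : Set M) (𝒜 : Set (VField n M)) : Prop :=
  (∀ x ∈ U, ∃ V : Set M, IsOpen V ∧ x ∈ V ∧ V ⊆ U ∧
    ∃ (X₀ : VField n M) (G : Fin r → VField n M), IsLocalGenerators 𝒜 V X₀ G) ∧
  ∀ X : VField n M, X ∈ 𝒜 ↔ X ∈ smoothFields U ∧ ∀ x ∈ U, X x ∈ fiberAt 𝒜 x

variable [RiemannianBundle (fun x : M => TangentSpace (𝓡 n) x)]

/-- A field of `n`-vectors. -/
abbrev TopVectorField (n : ℕ) (M : Type*) [TopologicalSpace M]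
    [ChartedSpace (EuclideanSpace ℝ (Fin n)) M] : Type _ :=
  (x : M) → ⋀[ℝ]^n (TangentSpace (𝓡 n) x)

/-- A smooth field of unit `n`-vectors on `V`, that is, an orientation of `V`: around each point of
`V` it is `e₁ ∧ ⋯ ∧ eₙ` for a smooth orthonormal moving frame. -/
def IsSmoothUnitVolume (V : Set M) (μ : TopVectorField n M) : Prop :=
  ∀ x ∈ V, ∃ W : Set M, IsOpen W ∧ x ∈ W ∧ W ⊆ V ∧
    ∃ e : Fin n → VField n M, (∀ i, e i ∈ smoothFields W) ∧
      ∀ y ∈ W, Orthonormal ℝ (fun i => e i y) ∧ μ y = wedgeAll fun i => e i y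

/-- `𝔛[F]`: the smooth vector fields on `U` that are orthogonal to all the `F i`. -/
def orthFields {ι : Type*} (U : Set M) (F : ι → VField n M) : Set (VField n M) :=
  {X | X ∈ smoothFields U ∧ ∀ i, ∀ x ∈ U, inner ℝ (X x) (F i x) = 0}

/-- `𝔄[X₀; F] = X₀ + 𝔛[F]`. -/
def affineFields {ι : Type*} (U : Set M) (X₀ : VField n M) (F : ι → VField n M) :
    Set (VField n M) :=
  {X | ∃ Y ∈ orthFields U F, X = X₀ + Y}

/-- The gradients `∇I₁, …, ∇I_k, ∇D₁, …, ∇D_p`. -/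
def gradFamily {k p : ℕ} (I : Fin k → M → ℝ) (D : Fin p → M → ℝ) : Fin k ⊕ Fin p → VField n M :=
  Sum.elim (fun l => grad (I l)) (fun j => grad (D j))

/-- `(∧_j ∇D_j ∧ ∧_l ∇I_l)(x)`. -/
def wedgeDI {k p : ℕ} (I : Fin k → M → ℝ) (D : Fin p → M → ℝ) (x : M) :
    ⋀[ℝ]^(p + k) (TangentSpace (𝓡 n) x) :=
  wedgeAll (fun j => grad (D j) x) ⋏ wedgeAll (fun l => grad (I l) x)

/-- `Θ_i = ⋆[∧_{j ≠ i} ∇D_j ∧ ∧_l ∇I_l ∧ ⋆(∧_j ∇D_j ∧ ∧_l ∇I_l)]`, with the Hodge stars taken with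
respect to `μ`. -/
def thetaField {k p : ℕ} (μ : TopVectorField n M) (I : Fin k → M → ℝ) (D : Fin p → M → ℝ)
    (i : Fin p) : VField n M := fun x =>
  exteriorPower.oneEquiv ℝ (TangentSpace (𝓡 n) x) <| hodgeStar (μ x) 1 <|
    wedgeOmit (fun j => grad (D j) x) i ⋏ wedgeAll (fun l => grad (I l) x) ⋏
      hodgeStar (μ x) (n - (k + p)) (wedgeDI I D x)

/-- `X₀ = ‖∧_j ∇D_j ∧ ∧_l ∇I_l‖⁻² ∑ᵢ (-1)^(n-i) hᵢ Θᵢ`. Since `Fin p` starts at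
`0`, the index `i ∈ {1, …, p}` of the formula is `(i : ℕ) + 1`. -/
def particularField {k p : ℕ} (μ : TopVectorField n M) (I : Fin k → M → ℝ) (D h : Fin p → M → ℝ) :
    VField n M := fun x =>
  (normPow (wedgeDI (n := n) I D x) ^ 2)⁻¹ •
    ∑ i : Fin p, ((-1 : ℝ) ^ (n - ((i : ℕ) + 1)) * h i x) • thetaField μ I D i x

/-- `⋆(∧_{i ≠ a} Z_i ∧ ∧_j ∇D_j ∧ ∧_l ∇I_l)`, with the Hodge star taken with respect to `ν`. -/
def generatorField {k p r : ℕ} (ν : TopVectorField n M) (Z : Fin r → VField n M) (I : Fin k → M → ℝ)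
    (D : Fin p → M → ℝ) (a : Fin r) : VField n M := fun x =>
  exteriorPower.oneEquiv ℝ (TangentSpace (𝓡 n) x) <| hodgeStar (ν x) 1 <|
    wedgeOmit (fun i => Z i x) a ⋏ wedgeDI I D x

end Riemannian

end

/-!
The theorem is pointwise linear algebra plus the smoothness of everything in sight.

*The particular field.* Write `w = d ∧ g` for `d = (∇Dⱼ)` and `g = (∇I_l)` at a point. Pairing `Θᵢ
= ⋆[∧_{j ≠ i} dⱼ ∧ g ∧ ⋆w]` with a vector `v` means multiplying by `v` from the right
(`inner_hodgeStar_one`); moving `v` into the gap left by `dᵢ` costs the sign `(-1)^(n-i)` and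
leaves `w[dᵢ := v] ∧ ⋆w`, which is `⟨w[dᵢ := v], w⟩ μ` by the second characterization `X ∧ ⋆ν =
⟨X, ν⟩ μ` of the Hodge star (`IsHodgeDual.wedge_eq`). By Cramer's rule this determinant divided by
`‖w‖²`, the Gram determinant, is the pairing of `v` with the `i`-th vector of the family dual to
`d, g` (`inner_gramDual_eq_det`). So `X₀ = ∑ᵢ hᵢ dⁱ` in terms of dual vectors
(`particularField_eq`): it is independent of the choice of `μ`, smooth, and satisfies `⟨X₀, ∇Dⱼ⟩ =
hⱼ`, `⟨X₀, ∇I_l⟩ = 0`.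

*The generators.* In the same way `⟨⋆(∧_{i ≠ a} Zᵢ ∧ w), v⟩` is, up to sign, the volume of the
frame with `Z_a` replaced by `v`. It vanishes for all vectors of the frame but `Z_a`, so that
these fields are a basis of the orthogonal complement of the gradients
(`mem_span_hodgeStar_wedgeOmit_iff`).

*Smoothness and extension.* Gram-Schmidt applied to a local frame of the tangent bundle gives
smooth orthonormal frames, hence a field is smooth once its inner products with such frames are
(`mem_smoothFields_of_inner`). For a gradient these are derivatives of a smooth function along
smooth fields, for the generators and the dual vectors `dⁱ` they are rational in inner products of
smooth fields.
That every vector `X₀(x) + v` with `v` orthogonal to the gradients is the value of a solution on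
all of `U` follows by extending `v` with a bump function, which needs `M` to be Hausdorff, and
subtracting the components along the gradients (`exists_orthField_apply_eq`). Moving frames that
extend the gradients exist because a Gram determinant which does not vanish at a point does not
vanish near it.
-/

/-! ### Wedge products and the Hodge star -/

theorem List.ofFn_omit {α : Type*} {m : ℕ} (w : Fin m → α) (i : Fin m) :
    (List.ofFn fun j : Fin (m - 1) =>
      w ⟨if (j : ℕ) < i then j else j + 1, by split_ifs <;> omega⟩)
      = (List.ofFn w).eraseIdx i := by
  refine List.ext_getElem (by simp [List.length_eraseIdx]) fun a h1 h2 => ?_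
  rw [List.getElem_eraseIdx, List.getElem_ofFn]
  split_ifs <;> simp

theorem List.ofFn_update {α : Type*} {m : ℕ} (w : Fin m → α) (i : Fin m) (v : α) :
    List.ofFn (Function.update w i v) = (List.ofFn w).set i v := by
  refine List.ext_getElem (by simp) fun a h1 h2 => ?_
  rw [List.getElem_set, List.getElem_ofFn]
  split_ifs with h
  · subst h; simp
  · rw [Function.update_of_ne (fun h' => h (congrArg Fin.val h').symm)]; simp

section Linear

variable {E : Type*} [NormedAddCommGroup E] [InnerProductSpace ℝ E]

theorem coe_wedgeMul {p q : ℕ} (x : ⋀[ℝ]^p E) (y : ⋀[ℝ]^q E) :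
    ((x ⋏ y : ⋀[ℝ]^(p + q) E) : ExteriorAlgebra ℝ E) = x * y := rfl

theorem wedgeAll_mul_wedgeAll {p q : ℕ} (v : Fin p → E) (w : Fin q → E) :
    wedgeAll v ⋏ wedgeAll w = wedgeAll (Fin.append v w) :=
  Subtype.ext (ExteriorAlgebra.ιMulti_mul_ιMulti v w)

theorem prod_map_ι_mul_ι (l : List E) (v : E) :
    (l.map (ExteriorAlgebra.ι ℝ)).prod * ExteriorAlgebra.ι ℝ v
      = (-1 : ℝ) ^ l.length •
        (ExteriorAlgebra.ι ℝ v * (l.map (ExteriorAlgebra.ι ℝ)).prod) := by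
  induction l with
  | nil => simp
  | cons a l ih =>
    have h : ExteriorAlgebra.ι ℝ a * ExteriorAlgebra.ι ℝ v
        = -(ExteriorAlgebra.ι ℝ v * ExteriorAlgebra.ι ℝ a) :=
      eq_neg_of_add_eq_zero_left (ExteriorAlgebra.ι_add_mul_swap a v)
    rw [List.map_cons, List.prod_cons, mul_assoc, ih, mul_smul_comm, ← mul_assoc, h,
      List.length_cons, pow_succ, mul_neg_one, neg_smul, neg_mul, smul_neg, mul_assoc]

/-- A vector commutes with a `q`-vector up to the sign `(-1)^q`. -/
theorem coe_mul_ι {q : ℕ} (x : ⋀[ℝ]^q E) (v : E) :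
    (x : ExteriorAlgebra ℝ E) * ExteriorAlgebra.ι ℝ v
      = (-1 : ℝ) ^ q • (ExteriorAlgebra.ι ℝ v * (x : ExteriorAlgebra ℝ E)) := by
  have hx : (x : ExteriorAlgebra ℝ E) ∈
      Submodule.span ℝ (Set.range (ExteriorAlgebra.ιMulti ℝ q (M := E))) := by
    rw [ExteriorAlgebra.ιMulti_span_fixedDegree]
    exact x.2
  generalize (x : ExteriorAlgebra ℝ E) = y at hx
  induction hx using Submodule.span_induction with
  | mem y hy =>
    obtain ⟨w, rfl⟩ := hy
    have h := prod_map_ι_mul_ι (List.ofFn w) v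
    rw [List.map_ofFn, List.length_ofFn] at h
    exact h
  | zero => simp
  | add a b _ _ ha hb => rw [add_mul, ha, hb, mul_add, smul_add]
  | smul c a _ ha => rw [smul_mul_assoc, ha, mul_smul_comm, smul_comm]

/-- Multiplying a wedge product with an omitted factor by `v` from the right puts `v` in the place
of that factor, up to the sign of moving `v` there. -/
theorem wedgeOmit_mul_ι {m : ℕ} (w : Fin m → E) (i : Fin m) (v : E) :
    (wedgeOmit w i : ExteriorAlgebra ℝ E) * ExteriorAlgebra.ι ℝ v
      = (-1 : ℝ) ^ (m - 1 - (i : ℕ)) •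
        (wedgeAll (Function.update w i v) : ExteriorAlgebra ℝ E) := by
  have h1 : (wedgeOmit w i : ExteriorAlgebra ℝ E)
      = (((List.ofFn w).eraseIdx i).map (ExteriorAlgebra.ι ℝ)).prod := by
    rw [← List.ofFn_omit, List.map_ofFn]
    rfl
  have h2 : (wedgeAll (Function.update w i v) : ExteriorAlgebra ℝ E)
      = (((List.ofFn w).set i v).map (ExteriorAlgebra.ι ℝ)).prod := by
    rw [← List.ofFn_update, List.map_ofFn]
    rfl
  rw [h1, h2, List.eraseIdx_eq_take_drop_succ,
    List.set_eq_take_append_cons_drop, if_pos (by simp), List.map_append, List.prod_append,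
    mul_assoc, prod_map_ι_mul_ι, mul_smul_comm, List.map_append, List.prod_append, List.map_cons,
    List.prod_cons]
  congr 2
  simp
  omega

theorem innerPow_basis_apply {n : ℕ} (e : OrthonormalBasis (Fin n) ℝ E) {q : ℕ}
    (s t : Set.powersetCard (Fin n) q) :
    innerPow q (e.toBasis.exteriorPower q s) (e.toBasis.exteriorPower q t)
      = if s = t then 1 else 0 := by
  rw [innerPow_basis, Module.Basis.coord_apply, Module.Basis.repr_self, Finsupp.single_apply]
  simp only [eq_comm]

theorem IsUnitVolume.innerPow_self {n : ℕ} {μ : ⋀[ℝ]^n E} (hμ : IsUnitVolume μ) :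
    innerPow n μ μ = 1 := by
  obtain ⟨e, he, rfl⟩ := hμ
  have : (Matrix.of fun i j => inner ℝ (e i) (e j)) = (1 : Matrix (Fin n) (Fin n) ℝ) := by
    ext i j
    simp [Matrix.one_apply, orthonormal_iff_ite.mp he i j]
  rw [innerPow_wedgeAll, this, Matrix.det_one]

/-- The functional `⟨μ, ·⟩` is the coordinate on the line of `n`-vectors. -/
theorem IsUnitVolume.eq_smul [FiniteDimensional ℝ E] {n : ℕ} (hn : Module.finrank ℝ E = n)
    {μ : ⋀[ℝ]^n E} (hμ : IsUnitVolume μ) (x : ⋀[ℝ]^n E) : x = innerPow n μ x • μ := by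
  obtain ⟨c, -, hc⟩ := exists_smul_unitVolume hn hμ
  conv_rhs => rw [← hc x]
  rw [map_smul, hμ.innerPow_self, smul_eq_mul, mul_one, hc]

/-- The wedge product as a bilinear map. -/
noncomputable def wedgeBilin (E : Type*) [NormedAddCommGroup E] [InnerProductSpace ℝ E] (p q : ℕ) :
    ⋀[ℝ]^p E →ₗ[ℝ] ⋀[ℝ]^q E →ₗ[ℝ] ⋀[ℝ]^(p + q) E :=
  LinearMap.mk₂ ℝ (fun x y => x ⋏ y) (fun _ _ _ => Subtype.ext (add_mul _ _ _))
    (fun _ _ _ => Subtype.ext (smul_mul_assoc _ _ _)) (fun _ _ _ => Subtype.ext (mul_add _ _ _))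
    fun _ _ _ => Subtype.ext (mul_smul_comm _ _ _)

/-- The wedge product of basis `p`- and `q`-vectors of an orthonormal basis of a
`(p + q)`-dimensional space vanishes unless their index sets are complementary, and then it is a
unit vector. -/
theorem innerPow_wedge_basis [FiniteDimensional ℝ E] {p q : ℕ}
    (hn : Module.finrank ℝ E = p + q) {μ : ⋀[ℝ]^(p + q) E} (hμ : IsUnitVolume μ)
    (e : OrthonormalBasis (Fin (p + q)) ℝ E) (s t : Set.powersetCard (Fin (p + q)) p)
    (r : Set.powersetCard (Fin (p + q)) q) :
    innerPow (p + q) μ (e.toBasis.exteriorPower p s ⋏ e.toBasis.exteriorPower q r) *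
      innerPow (p + q) μ (e.toBasis.exteriorPower p t ⋏ e.toBasis.exteriorPower q r)
      = if s = t ∧ r = Set.powersetCard.compl (m := q) (n := p) (by simp [add_comm]) s
        then 1 else 0 := by
  have zero_of : ∀ s : Set.powersetCard (Fin (p + q)) p,
      r ≠ Set.powersetCard.compl (m := q) (n := p) (by simp [add_comm]) s →
      e.toBasis.exteriorPower p s ⋏ e.toBasis.exteriorPower q r = 0 := by
    intro s hs
    refine Subtype.ext ?_
    rw [coe_wedgeMul, exteriorPower.basis_apply, exteriorPower.basis_apply]
    refine ExteriorAlgebra.ιMulti_family_mul_of_not_disjoint ℝ _ s r fun hd => hs ?_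
    refine Subtype.ext (Finset.eq_of_subset_of_card_le (fun a ha => ?_) ?_)
    · exact Set.powersetCard.mem_compl.mpr fun h => Finset.disjoint_left.mp hd h ha
    · rw [Set.powersetCard.mem_iff.mp r.2, Set.powersetCard.mem_iff.mp (Subtype.prop _)]
  by_cases hs : r = Set.powersetCard.compl (m := q) (n := p) (by simp [add_comm]) s
  · by_cases hst : s = t
    · subst hst
      rw [if_pos ⟨rfl, hs⟩]
      have hd : Disjoint s.val r.val := by
        rw [hs]
        exact disjoint_compl_right
      have h1 := ExteriorAlgebra.ιMulti_family_mul_of_disjoint ℝ e.toBasis s r hd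
      set x := e.toBasis.exteriorPower p s ⋏ e.toBasis.exteriorPower q r with hx
      set ε := (Set.powersetCard.permOfDisjoint hd).sign
      set u := e.toBasis.exteriorPower (p + q) (Set.powersetCard.disjUnion hd) with hu
      have h2 : x = (ε : ℤ) • u := by
        refine Subtype.ext ?_
        rw [hx, hu, coe_wedgeMul, exteriorPower.basis_apply, exteriorPower.basis_apply,
          exteriorPower.basis_apply]
        exact h1
      have h3 : innerPow (p + q) x x = 1 := by
        rw [h2, map_zsmul, map_zsmul, LinearMap.smul_apply, hu, innerPow_basis_apply, if_pos rfl]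
        rcases Int.units_eq_one_or ε with h | h <;> simp [h]
      rw [hμ.eq_smul hn x] at h3
      simpa [hμ.innerPow_self] using h3
    · rw [if_neg fun h => hst h.1, zero_of t, map_zero, mul_zero]
      rw [hs]
      exact fun h => hst ((Set.powersetCard.compl _).injective h)
  · rw [if_neg fun h => hs h.2, zero_of s hs, map_zero, zero_mul]

/-- The second characterization of the Hodge star: `X ∧ ⋆ν = ⟨X, ν⟩ μ`. -/
theorem IsHodgeDual.wedge_eq [FiniteDimensional ℝ E] {n p q : ℕ}
    (hn : Module.finrank ℝ E = n) (hpq : p + q = n) {μ : ⋀[ℝ]^n E} (hμ : IsUnitVolume μ)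
    {ν : ⋀[ℝ]^p E} {σ : ⋀[ℝ]^q E} (hσ : IsHodgeDual μ ν σ) (x : ⋀[ℝ]^p E) :
    (x : ExteriorAlgebra ℝ E) * σ = innerPow p x ν • (μ : ExteriorAlgebra ℝ E) := by
  subst hpq
  let e : OrthonormalBasis (Fin (p + q)) ℝ E := (stdOrthonormalBasis ℝ E).reindex (finCongr hn)
  let bp := e.toBasis.exteriorPower p
  let bq := e.toBasis.exteriorPower q
  let B : ⋀[ℝ]^p E →ₗ[ℝ] ⋀[ℝ]^q E →ₗ[ℝ] ℝ :=
    (wedgeBilin E p q).compr₂ (innerPow (p + q) μ)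
  have hB : ∀ x y, B x y = innerPow (p + q) μ (x ⋏ y) := fun x y => rfl
  have h1 : ∀ η, innerPow q σ η = B ν η := by
    intro η
    have h := hσ η
    have h' : innerPow q σ η • μ = ν ⋏ η := Subtype.ext h
    rw [hB, ← h', map_smul, hμ.innerPow_self, smul_eq_mul, mul_one]
  -- the coordinates of `σ` are its products with the orthonormal basis `bq`
  have h2 : σ = ∑ r, B ν (bq r) • bq r := by
    have h : ∀ r, bq.repr σ r = B ν (bq r) := by
      intro r
      rw [← h1]
      conv_rhs => rw [← bq.sum_repr σ]
      simp only [map_sum, map_smul, LinearMap.sum_apply, LinearMap.smul_apply]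
      simp only [bq, innerPow_basis_apply]
      simp
    conv_lhs => rw [← bq.sum_repr σ]
    simp only [h]
  -- both sides of `⟨x, ν⟩ = ∑ᵣ B x eᵣ * B ν eᵣ` are bilinear, so it suffices to compare on a basis
  have h3 : ∑ r, (LinearMap.mul ℝ ℝ).compl₁₂ (B.flip (bq r)) (B.flip (bq r)) = innerPow p := by
    refine bp.ext fun s => bp.ext fun t => ?_
    simp only [LinearMap.sum_apply, LinearMap.compl₁₂_apply, LinearMap.flip_apply,
      LinearMap.mul_apply', hB]
    simp only [bp, bq, innerPow_wedge_basis hn hμ, innerPow_basis_apply]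
    by_cases hst : s = t <;> simp [hst]
  have h4 : B x σ = innerPow p x ν := by
    rw [h2, map_sum, ← h3, LinearMap.sum_apply, LinearMap.sum_apply]
    refine Finset.sum_congr rfl fun r _ => ?_
    rw [map_smul, smul_eq_mul, mul_comm]
    rfl
  rw [← h4, hB]
  exact congrArg Subtype.val (hμ.eq_smul hn (x ⋏ σ))

theorem wedgeMul_oneEquiv_symm {p : ℕ} (ν : ⋀[ℝ]^p E) (v : E) :
    ((ν ⋏ (exteriorPower.oneEquiv ℝ E).symm v : ⋀[ℝ]^(p + 1) E) : ExteriorAlgebra ℝ E)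
      = ν * ExteriorAlgebra.ι ℝ v := by
  rw [coe_wedgeMul, exteriorPower.oneEquiv_symm_apply, exteriorPower.ιMulti_apply_coe,
    ExteriorAlgebra.ιMulti_succ_apply, ExteriorAlgebra.ιMulti_zero_apply, mul_one]

theorem innerPow_one (x : ⋀[ℝ]^1 E) (v : E) :
    innerPow 1 x ((exteriorPower.oneEquiv ℝ E).symm v)
      = inner ℝ (exteriorPower.oneEquiv ℝ E x) v := by
  obtain ⟨w, rfl⟩ := (exteriorPower.oneEquiv ℝ E).symm.surjective x
  rw [LinearEquiv.apply_symm_apply, exteriorPower.oneEquiv_symm_apply,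
    exteriorPower.oneEquiv_symm_apply]
  exact (innerPow_wedgeAll _ _).trans (by simp)

/-- The vector `⋆ν` of an `(n-1)`-vector `ν` is given by `⟨⋆ν, v⟩ μ = ν ∧ v`. -/
theorem inner_hodgeStar_one [FiniteDimensional ℝ E] {n p : ℕ}
    (hn : Module.finrank ℝ E = n) (hp : p + 1 = n) {μ : ⋀[ℝ]^n E} (hμ : IsUnitVolume μ)
    (ν : ⋀[ℝ]^p E) (v : E) :
    inner ℝ (exteriorPower.oneEquiv ℝ E (hodgeStar μ 1 ν)) v • (μ : ExteriorAlgebra ℝ E)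
      = ν * ExteriorAlgebra.ι ℝ v := by
  have h := (isHodgeDual_iff_eq_hodgeStar hn hp hμ ν _).mpr rfl
    ((exteriorPower.oneEquiv ℝ E).symm v)
  rwa [innerPow_one, wedgeMul_oneEquiv_symm] at h

end Linear

/-! ### The family dual to a linearly independent family -/

section GramDual

variable {E : Type*} [NormedAddCommGroup E] [InnerProductSpace ℝ E]
variable {ι : Type*} [Fintype ι] [DecidableEq ι]

/-- The family in the span of `f` that is dual to `f` with respect to the inner product:
`f^i = ∑ⱼ (G⁻¹)ᵢⱼ fⱼ`, where `G` is the Gram matrix of `f`. -/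
noncomputable def gramDual (f : ι → E) (i : ι) : E := ∑ j, (Matrix.gram ℝ f)⁻¹ i j • f j

theorem inner_gramDual (f : ι → E) (i : ι) (v : E) :
    inner ℝ (gramDual f i) v = ((Matrix.gram ℝ f)⁻¹.mulVec fun j => inner ℝ (f j) v) i := by
  simp only [gramDual, sum_inner, real_inner_smul_left]
  rfl

/-- Cramer's rule for the dual family. -/
theorem inner_gramDual_eq_det (f : ι → E) (i : ι) (v : E) :
    inner ℝ (gramDual f i) v = (Matrix.gram ℝ f).det⁻¹ *
      (Matrix.of fun a b => inner ℝ (Function.update f i v a) (f b)).det := by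
  have h : (Matrix.of fun a b => inner ℝ (Function.update f i v a) (f b)).transpose
      = (Matrix.gram ℝ f).updateCol i fun j => inner ℝ (f j) v := by
    ext a b
    by_cases hb : b = i
    · subst hb
      simp [real_inner_comm]
    · simp [hb, real_inner_comm]
  rw [inner_gramDual, Matrix.inv_def, Matrix.smul_mulVec, ← Matrix.cramer_eq_adjugate_mulVec,
    Pi.smul_apply, Matrix.cramer_apply, ← h, Matrix.det_transpose, Ring.inverse_eq_inv',
    smul_eq_mul]

theorem inner_gramDual_self {f : ι → E} (hf : LinearIndependent ℝ f) (i j : ι) :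
    inner ℝ (gramDual f i) (f j) = if i = j then 1 else 0 := by
  have hdet : IsUnit (Matrix.gram ℝ f).det :=
    (Matrix.det_gram_ne_zero_iff_linearIndependent.mpr hf).isUnit
  have h := congrFun (congrFun (Matrix.nonsing_inv_mul _ hdet) i) j
  rw [Matrix.one_apply] at h
  rw [inner_gramDual, ← h]
  rfl

end GramDual

/-! ### Hodge stars of wedge products with an omitted factor -/

section Hodge

variable {E : Type*} [NormedAddCommGroup E] [InnerProductSpace ℝ E]

theorem normPow_wedgeAll_sq {m : ℕ} (f : Fin m → E) :
    normPow (wedgeAll f) ^ 2 = (Matrix.gram ℝ f).det := by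
  have h : innerPow m (wedgeAll f) (wedgeAll f) = (Matrix.gram ℝ f).det := innerPow_wedgeAll f f
  rw [normPow, h, Real.sq_sqrt (Matrix.posSemidef_gram ℝ f).det_nonneg]

theorem Fin.append_update_castAdd {α : Type*} {p k : ℕ} (f : Fin p → α) (g : Fin k → α)
    (i : Fin p) (v : α) :
    Fin.append (Function.update f i v) g
      = Function.update (Fin.append f g) (Fin.castAdd k i) v := by
  funext a
  refine Fin.addCases (fun b => ?_) (fun b => ?_) a
  · by_cases h : b = i
    · subst h
      simp
    · rw [Function.update_of_ne (fun h' => h (Fin.castAdd_injective _ _ h')), Fin.append_left,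
        Fin.append_left, Function.update_of_ne h]
  · rw [Function.update_of_ne, Fin.append_right, Fin.append_right]
    intro h
    have := congrArg Fin.val h
    simp at this
    omega

/-- The vector `⋆[∧_{j ≠ i} d_j ∧ ∧_l g_l ∧ ⋆(∧_j d_j ∧ ∧_l g_l)]` is a multiple of the `i`-th
vector of the family dual to `d, g`: pairing it with `v` amounts to moving `v` into the gap at `i`, past
a `q`-vector, a `k`-vector and `p - 1 - i` vectors, and `q + k + (p - 1 - i) = n - (i + 1)`. -/
theorem hodgeStar_wedgeOmit_wedge_hodgeStar [FiniteDimensional ℝ E] {n k p q : ℕ}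
    (hn : Module.finrank ℝ E = n) (hq : p + k + q = n) {μ : ⋀[ℝ]^n E} (hμ : IsUnitVolume μ)
    (d : Fin p → E) (g : Fin k → E) (hdg : LinearIndependent ℝ (Fin.append d g)) (i : Fin p) :
    exteriorPower.oneEquiv ℝ E (hodgeStar μ 1
      (wedgeOmit d i ⋏ wedgeAll g ⋏ hodgeStar μ q (wedgeAll d ⋏ wedgeAll g)))
      = ((-1 : ℝ) ^ (n - ((i : ℕ) + 1)) * (Matrix.gram ℝ (Fin.append d g)).det) •
        gramDual (Fin.append d g) (Fin.castAdd k i) := by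
  have hp : p - 1 + k + q + 1 = n := by have := i.2; omega
  have hμ0 : (μ : ExteriorAlgebra ℝ E) ≠ 0 := by
    obtain ⟨-, h, -⟩ := exists_smul_unitVolume hn hμ
    exact fun h' => h (Subtype.ext h')
  refine ext_inner_right ℝ fun v => smul_left_injective ℝ hμ0 ?_
  dsimp only
  rw [inner_hodgeStar_one hn hp hμ, coe_wedgeMul, mul_assoc, coe_mul_ι, mul_smul_comm,
    ← mul_assoc, coe_wedgeMul, mul_assoc _ _ (ExteriorAlgebra.ι ℝ v), coe_mul_ι, mul_smul_comm,
    ← mul_assoc, wedgeOmit_mul_ι, smul_mul_assoc, smul_mul_assoc, smul_mul_assoc,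
    ← coe_wedgeMul, wedgeAll_mul_wedgeAll,
    ((isHodgeDual_iff_eq_hodgeStar hn hq hμ _ _).mpr rfl).wedge_eq hn hq hμ,
    wedgeAll_mul_wedgeAll, innerPow_wedgeAll, smul_smul, smul_smul, smul_smul,
    real_inner_smul_left, inner_gramDual_eq_det, Fin.append_update_castAdd,
    ← mul_assoc, ← pow_add, ← pow_add, mul_assoc ((-1 : ℝ) ^ (n - (↑i + 1))),
    mul_inv_cancel₀ (Matrix.det_gram_ne_zero_iff_linearIndependent.mpr hdg),
    mul_one]
  congr 3
  omega

/-- Pairing `⋆(∧_{i ≠ a} z_i ∧ w)` with `v` puts `v` in the place of `z_a`. -/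
theorem inner_hodgeStar_wedgeOmit [FiniteDimensional ℝ E] {n r m : ℕ}
    (hn : Module.finrank ℝ E = n) (hr : r + m = n) {μ : ⋀[ℝ]^n E} (hμ : IsUnitVolume μ)
    (z : Fin r → E) (w : Fin m → E) (a : Fin r) (v : E) :
    inner ℝ (exteriorPower.oneEquiv ℝ E (hodgeStar μ 1 (wedgeOmit z a ⋏ wedgeAll w))) v •
        (μ : ExteriorAlgebra ℝ E)
      = (-1 : ℝ) ^ (m + (r - 1 - (a : ℕ))) •
        (wedgeAll (Function.update (Fin.append z w) (Fin.castAdd m a) v) :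
          ExteriorAlgebra ℝ E) := by
  have hp : r - 1 + m + 1 = n := by have := a.2; omega
  rw [inner_hodgeStar_one hn hp hμ, coe_wedgeMul, mul_assoc, coe_mul_ι, mul_smul_comm,
    ← mul_assoc, wedgeOmit_mul_ι, smul_mul_assoc, smul_smul, ← pow_add, ← coe_wedgeMul,
    wedgeAll_mul_wedgeAll, Fin.append_update_castAdd]

/-- In terms of an orthonormal basis, the components of `⋆(∧_{i ≠ a} z_i ∧ w)` are determinants of
inner products. -/
theorem inner_hodgeStar_wedgeOmit_eq_det [FiniteDimensional ℝ E] {n r m : ℕ}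
    (hn : Module.finrank ℝ E = n) (hr : r + m = n) {e : Fin n → E} (he : Orthonormal ℝ e)
    (z : Fin r → E) (w : Fin m → E) (a : Fin r) (v : E) :
    inner ℝ (exteriorPower.oneEquiv ℝ E (hodgeStar (wedgeAll e) 1 (wedgeOmit z a ⋏ wedgeAll w))) v
      = (-1 : ℝ) ^ (m + (r - 1 - (a : ℕ))) *
        (Matrix.of fun i j => inner ℝ (e (Fin.cast hr i))
          (Function.update (Fin.append z w) (Fin.castAdd m a) v j)).det := by
  subst hr
  have hμ : IsUnitVolume (wedgeAll e) := ⟨e, he, rfl⟩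
  have h := inner_hodgeStar_wedgeOmit hn rfl hμ z w a v
  have h' := congrArg (innerPow (r + m) (wedgeAll e)) (Subtype.ext h :
    inner ℝ (exteriorPower.oneEquiv ℝ E
      (hodgeStar (wedgeAll e) 1 (wedgeOmit z a ⋏ wedgeAll w))) v • wedgeAll e
      = (-1 : ℝ) ^ (m + (r - 1 - (a : ℕ))) •
        wedgeAll (Function.update (Fin.append z w) (Fin.castAdd m a) v))
  rw [map_smul, map_smul, hμ.innerPow_self, innerPow_wedgeAll, smul_eq_mul, mul_one] at h'
  exact h'

theorem coe_wedgeAll_ne_zero {m : ℕ} {f : Fin m → E} (hf : LinearIndependent ℝ f) :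
    (wedgeAll f : ExteriorAlgebra ℝ E) ≠ 0 := by
  intro h
  have h1 : innerPow m (wedgeAll f) (wedgeAll f) = (Matrix.gram ℝ f).det := innerPow_wedgeAll f f
  rw [show wedgeAll f = 0 from Subtype.ext h, map_zero] at h1
  exact Matrix.det_gram_ne_zero_iff_linearIndependent.mpr hf h1.symm

/-- For `z, w` a basis, `⋆(∧_{i ≠ a} z_i ∧ w)` is orthogonal to all vectors of the basis
but `z_a`. -/
theorem inner_hodgeStar_wedgeOmit_append [FiniteDimensional ℝ E] {n r m : ℕ}
    (hn : Module.finrank ℝ E = n) (hr : r + m = n) {μ : ⋀[ℝ]^n E} (hμ : IsUnitVolume μ)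
    (z : Fin r → E) (w : Fin m → E) (hzw : LinearIndependent ℝ (Fin.append z w)) (a : Fin r)
    (b : Fin (r + m)) :
    inner ℝ (exteriorPower.oneEquiv ℝ E (hodgeStar μ 1 (wedgeOmit z a ⋏ wedgeAll w)))
      (Fin.append z w b) = 0 ↔ b ≠ Fin.castAdd m a := by
  have h := inner_hodgeStar_wedgeOmit hn hr hμ z w a (Fin.append z w b)
  constructor
  · rintro h0 rfl
    rw [h0, Function.update_eq_self, zero_smul] at h
    exact smul_ne_zero (pow_ne_zero _ (by norm_num)) (coe_wedgeAll_ne_zero hzw) h.symm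
  · intro hb
    have hμ0 : (μ : ExteriorAlgebra ℝ E) ≠ 0 := by
      obtain ⟨-, h, -⟩ := exists_smul_unitVolume hn hμ
      exact fun h' => h (Subtype.ext h')
    have h1 : (wedgeAll (Function.update (Fin.append z w) (Fin.castAdd m a) (Fin.append z w b)) :
        ExteriorAlgebra ℝ E) = 0 :=
      (ExteriorAlgebra.ιMulti ℝ (r + m)).map_eq_zero_of_eq _
        (by rw [Function.update_self, Function.update_of_ne hb]) hb.symm
    rw [h1, smul_zero] at h
    exact (smul_eq_zero.mp h).resolve_right hμ0

theorem linearIndependent_hodgeStar_wedgeOmit [FiniteDimensional ℝ E] {n r m : ℕ}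
    (hn : Module.finrank ℝ E = n) (hr : r + m = n) {μ : ⋀[ℝ]^n E} (hμ : IsUnitVolume μ)
    (z : Fin r → E) (w : Fin m → E) (hzw : LinearIndependent ℝ (Fin.append z w)) :
    LinearIndependent ℝ fun a =>
      exteriorPower.oneEquiv ℝ E (hodgeStar μ 1 (wedgeOmit z a ⋏ wedgeAll w)) := by
  rw [Fintype.linearIndependent_iff]
  intro c hc b
  have h := congrArg (fun x => inner ℝ x (Fin.append z w (Fin.castAdd m b))) hc
  simp only [sum_inner, real_inner_smul_left, inner_zero_left] at h
  rw [Finset.sum_eq_single b] at h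
  · refine (mul_eq_zero.mp h).resolve_right fun h0 => ?_
    exact (inner_hodgeStar_wedgeOmit_append hn hr hμ z w hzw b _).mp h0 rfl
  · intro a _ hab
    rw [(inner_hodgeStar_wedgeOmit_append hn hr hμ z w hzw a _).mpr, mul_zero]
    exact fun h => hab (Fin.castAdd_injective _ _ h).symm
  · simp

/-- For `z, w` a basis, the vectors `⋆(∧_{i ≠ a} z_i ∧ w)` span the orthogonal complement of `w`:
they are orthogonal to `w`, and there are enough of them. -/
theorem mem_span_hodgeStar_wedgeOmit_iff [FiniteDimensional ℝ E] {n r m : ℕ}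
    (hn : Module.finrank ℝ E = n) (hr : r + m = n) {μ : ⋀[ℝ]^n E} (hμ : IsUnitVolume μ)
    (z : Fin r → E) (w : Fin m → E) (hzw : LinearIndependent ℝ (Fin.append z w)) (v : E) :
    v ∈ Submodule.span ℝ (Set.range fun a =>
      exteriorPower.oneEquiv ℝ E (hodgeStar μ 1 (wedgeOmit z a ⋏ wedgeAll w)))
      ↔ ∀ j, inner ℝ v (w j) = 0 := by
  have hw : LinearIndependent ℝ w := by
    have h := hzw.comp (Fin.natAdd r) (Fin.natAdd_injective _ _)
    rwa [show Fin.append z w ∘ Fin.natAdd r = w from funext fun j => Fin.append_right z w j] at h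
  have hle : Submodule.span ℝ (Set.range fun a =>
      exteriorPower.oneEquiv ℝ E (hodgeStar μ 1 (wedgeOmit z a ⋏ wedgeAll w)))
      ≤ (Submodule.span ℝ (Set.range w))ᗮ := by
    rw [Submodule.span_le]
    rintro _ ⟨a, rfl⟩
    rw [SetLike.mem_coe, ← Submodule.span_singleton_le_iff_mem,
      Submodule.le_orthogonal_iff_le_orthogonal, Submodule.span_le]
    rintro _ ⟨j, rfl⟩
    rw [SetLike.mem_coe, Submodule.mem_orthogonal_singleton_iff_inner_right,
      ← Fin.append_right z w j]
    refine (inner_hodgeStar_wedgeOmit_append hn hr hμ z w hzw a _).mpr fun h => ?_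
    have := congrArg Fin.val h
    simp at this
    omega
  have heq := Submodule.eq_of_le_of_finrank_eq hle (by
    have h := (Submodule.span ℝ (Set.range w)).finrank_add_finrank_orthogonal
    rw [finrank_span_eq_card hw, hn, Fintype.card_fin] at h
    rw [finrank_span_eq_card (linearIndependent_hodgeStar_wedgeOmit hn hr hμ z w hzw),
      Fintype.card_fin]
    omega)
  rw [heq, ← Submodule.span_singleton_le_iff_mem, Submodule.le_orthogonal_iff_le_orthogonal,
    Submodule.span_le]
  simp only [Set.range_subset_iff, SetLike.mem_coe,
    Submodule.mem_orthogonal_singleton_iff_inner_right]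

end Hodge

/-! ### Smooth vector fields on a Riemannian manifold -/

section Smooth

variable {n : ℕ} {M : Type*} [TopologicalSpace M] [ChartedSpace (EuclideanSpace ℝ (Fin n)) M]

section Functions

variable {U : Set M}

theorem IsSmoothFun.det {m : Type*} [Fintype m] [DecidableEq m] {A : M → Matrix m m ℝ}
    (hA : ∀ i j, IsSmoothFun (n := n) U fun x => A x i j) :
    IsSmoothFun (n := n) U fun x => (A x).det := by
  simp only [Matrix.det_apply']
  refine contMDiffOn_finsetSum fun σ _ => contMDiffOn_const.mul ?_
  exact contMDiffOn_finsetProd fun i _ => hA _ _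

theorem IsSmoothFun.sqrt {f : M → ℝ} (hf : IsSmoothFun (n := n) U f) (h0 : ∀ x ∈ U, f x ≠ 0) :
    IsSmoothFun (n := n) U fun x => √(f x) := fun x hx =>
  ((Real.contDiffAt_sqrt (h0 x hx)).contMDiffAt).comp_contMDiffWithinAt x (hf x hx)

end Functions

theorem finrank_tangentSpace (x : M) : Module.finrank ℝ (TangentSpace (𝓡 n) x) = n :=
  (finrank_euclideanSpace_fin : Module.finrank ℝ (EuclideanSpace ℝ (Fin n)) = n)

instance finiteDimensional_tangentSpace (x : M) : FiniteDimensional ℝ (TangentSpace (𝓡 n) x) :=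
  inferInstanceAs (FiniteDimensional ℝ (EuclideanSpace ℝ (Fin n)))

theorem Orthonormal.eq_sum_inner_smul {E : Type*} [NormedAddCommGroup E] [InnerProductSpace ℝ E]
    [FiniteDimensional ℝ E] {n : ℕ} (hn : Module.finrank ℝ E = n) {e : Fin n → E}
    (he : Orthonormal ℝ e) (v : E) : v = ∑ i, inner ℝ v (e i) • e i := by
  let b : OrthonormalBasis (Fin n) ℝ E := OrthonormalBasis.mk he
    (he.linearIndependent.span_eq_top_of_card_eq_finrank' (by simp [hn])).ge
  have h := (b.sum_repr' v).symm
  simpa [b, real_inner_comm] using h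

theorem eq_sum_inner_smul_of_orthonormal
    [RiemannianBundle (fun x : M => TangentSpace (𝓡 n) x)] {y : M}
    {e : Fin n → TangentSpace (𝓡 n) y}
    (he : Orthonormal ℝ e) (v : TangentSpace (𝓡 n) y) : v = ∑ i, inner ℝ v (e i) • e i :=
  he.eq_sum_inner_smul (by exact finrank_tangentSpace y) v

theorem lieDeriv_eq_inner_grad [RiemannianBundle (fun x : M => TangentSpace (𝓡 n) x)]
    (X : VField n M) (f : M → ℝ) (x : M) :
    lieDeriv X f x = inner ℝ (grad f x) (X x) := (inner_grad f x (X x)).symm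

variable [IsManifold (𝓡 n) ∞ M] {U : Set M}

theorem smoothFields_mono {V : Set M} (h : V ⊆ U) {X : VField n M} (hX : X ∈ smoothFields U) :
    X ∈ smoothFields V := ContMDiffOn.mono hX h

theorem smoothFields_add {X Y : VField n M} (hX : X ∈ smoothFields U) (hY : Y ∈ smoothFields U) :
    X + Y ∈ smoothFields U := ContMDiffOn.add_section hX hY

theorem smoothFields_sub {X Y : VField n M} (hX : X ∈ smoothFields U) (hY : Y ∈ smoothFields U) :
    X - Y ∈ smoothFields U := ContMDiffOn.sub_section hX hY

theorem smoothFields_smul {f : M → ℝ} {X : VField n M} (hf : IsSmoothFun (n := n) U f)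
    (hX : X ∈ smoothFields U) : (fun x => f x • X x) ∈ smoothFields U :=
  ContMDiffOn.smul_section hf hX

theorem smoothFields_sum {ι : Type*} {s : Finset ι} {X : ι → VField n M}
    (hX : ∀ i ∈ s, X i ∈ smoothFields U) : (fun x => ∑ i ∈ s, X i x) ∈ smoothFields U :=
  ContMDiffOn.sum_section (t := fun i x => X i x) hX

theorem smoothFields_sum_smul {ι : Type*} [Fintype ι] {c : ι → M → ℝ} {X : ι → VField n M}
    (hc : ∀ i, IsSmoothFun (n := n) U (c i)) (hX : ∀ i, X i ∈ smoothFields U) :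
    (fun x => ∑ i, c i x • X i x) ∈ smoothFields U :=
  smoothFields_sum fun i _ => smoothFields_smul (hc i) (hX i)

theorem smoothFields_congr {X Y : VField n M} (hX : X ∈ smoothFields U)
    (h : ∀ x ∈ U, Y x = X x) : Y ∈ smoothFields U :=
  ContMDiffOn.congr hX fun x hx => by rw [h x hx]

/-- The derivative of a smooth function along a smooth vector field is smooth. -/
theorem isSmoothFun_lieDeriv (hU : IsOpen U) {f : M → ℝ} (hf : IsSmoothFun (n := n) U f)
    {X : VField n M} (hX : X ∈ smoothFields U) : IsSmoothFun (n := n) U (lieDeriv X f) := by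
  have h1 := (ContMDiffOn.contMDiffOn_tangentMapWithin (m := ∞) hf (by simp)
    hU.uniqueMDiffOn).comp hX fun x hx => hx
  have h2 := (contMDiff_snd_tangentBundle_modelSpace ℝ 𝓘(ℝ, ℝ) (n := ∞)).comp_contMDiffOn h1
  refine h2.congr fun x hx => ?_
  change _ = mfderivWithin (𝓡 n) 𝓘(ℝ, ℝ) f U x (X x)
  rw [mfderivWithin_of_isOpen hU hx]
  rfl

variable [RiemannianBundle (fun x : M => TangentSpace (𝓡 n) x)]

variable [IsContMDiffRiemannianBundle (𝓡 n) ∞ (EuclideanSpace ℝ (Fin n))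
      (fun x : M => TangentSpace (𝓡 n) x)]

theorem isSmoothFun_inner {X Y : VField n M} (hX : X ∈ smoothFields U) (hY : Y ∈ smoothFields U) :
    IsSmoothFun (n := n) U fun x => inner ℝ (X x) (Y x) :=
  ContMDiffOn.inner_bundle hX hY

/-- The Gram-Schmidt process preserves smoothness. -/
theorem gramSchmidt_mem_smoothFields {e : Fin n → VField n M} (he : ∀ i, e i ∈ smoothFields U)
    (hind : ∀ x ∈ U, LinearIndependent ℝ fun i => e i x) (i : Fin n) :
    (fun x => InnerProductSpace.gramSchmidt ℝ (fun j => e j x) i) ∈ smoothFields U := by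
  induction i using WellFoundedLT.induction with
  | _ i ih =>
    have hne : ∀ j, ∀ x ∈ U, inner ℝ (InnerProductSpace.gramSchmidt ℝ (fun j => e j x) j)
        (InnerProductSpace.gramSchmidt ℝ (fun j => e j x) j) ≠ 0 := fun j x hx =>
      inner_self_ne_zero.mpr (InnerProductSpace.gramSchmidt_ne_zero j (hind x hx))
    refine smoothFields_congr (smoothFields_sub (he i) (smoothFields_sum (s := Finset.Iio i)
      (X := fun j x => (inner ℝ (InnerProductSpace.gramSchmidt ℝ (fun j => e j x) j) (e i x) *
        (inner ℝ (InnerProductSpace.gramSchmidt ℝ (fun j => e j x) j)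
          (InnerProductSpace.gramSchmidt ℝ (fun j => e j x) j))⁻¹) •
        InnerProductSpace.gramSchmidt ℝ (fun j => e j x) j) fun j hj => ?_)) fun x hx => ?_
    · have hj' := ih j (Finset.mem_Iio.mp hj)
      exact smoothFields_smul (ContMDiffOn.mul (isSmoothFun_inner hj' (he i))
        (ContMDiffOn.inv₀ (isSmoothFun_inner hj' hj') (hne j))) hj'
    · rw [InnerProductSpace.gramSchmidt_def, Pi.sub_apply]
      congr 1
      refine Finset.sum_congr rfl fun j _ => ?_
      rw [Submodule.starProjection_singleton, real_inner_self_eq_norm_sq, div_eq_mul_inv]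
      rfl

/-- Smooth orthonormal frames exist locally: normalize the Gram-Schmidt orthogonalization of a frame
given by a trivialization of the tangent bundle. -/
theorem exists_orthonormalFrame (hU : IsOpen U) {x : M} (hx : x ∈ U) :
    ∃ W : Set M, IsOpen W ∧ x ∈ W ∧ W ⊆ U ∧ ∃ e : Fin n → VField n M,
      (∀ i, e i ∈ smoothFields W) ∧ ∀ y ∈ W, Orthonormal ℝ fun i => e i y := by
  let t := trivializationAt (EuclideanSpace ℝ (Fin n)) (TangentSpace (𝓡 n) : M → Type _) x
  let b : Module.Basis (Fin n) ℝ (EuclideanSpace ℝ (Fin n)) :=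
    (EuclideanSpace.basisFun (Fin n) ℝ).toBasis
  have hs := t.isLocalFrameOn_localFrame_baseSet (𝓡 n) ∞ b
  let s : Fin n → VField n M := t.localFrame b
  let g : Fin n → VField n M := fun i y => InnerProductSpace.gramSchmidt ℝ (fun j => s j y) i
  have hind : ∀ y ∈ U ∩ t.baseSet, LinearIndependent ℝ fun i => s i y :=
    fun y hy => hs.linearIndependent hy.2
  have hg : ∀ i, g i ∈ smoothFields (U ∩ t.baseSet) :=
    gramSchmidt_mem_smoothFields
      (fun i => smoothFields_mono Set.inter_subset_right (hs.contMDiffOn i)) hind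
  have hne : ∀ i, ∀ y ∈ U ∩ t.baseSet, inner ℝ (g i y) (g i y) ≠ 0 := fun i y hy =>
    inner_self_ne_zero.mpr (InnerProductSpace.gramSchmidt_ne_zero i (hind y hy))
  refine ⟨U ∩ t.baseSet, hU.inter t.open_baseSet,
    ⟨hx, FiberBundle.mem_baseSet_trivializationAt' x⟩, Set.inter_subset_left,
    fun i y => (√(inner ℝ (g i y) (g i y)))⁻¹ • g i y, fun i => ?_, fun y hy => ?_⟩
  · exact smoothFields_smul (ContMDiffOn.inv₀ ((isSmoothFun_inner (hg i) (hg i)).sqrt (hne i))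
      fun y hy => (Real.sqrt_ne_zero real_inner_self_nonneg).mpr (hne i y hy)) (hg i)
  · convert InnerProductSpace.gramSchmidtNormed_orthonormal (hind y hy) using 2 with i
    dsimp only
    rw [← norm_eq_sqrt_real_inner]
    rfl

/-- A vector field is smooth as soon as its components in smooth orthonormal frames are. -/
theorem mem_smoothFields_of_inner (hU : IsOpen U) {X : VField n M}
    (hX : ∀ W ⊆ U, IsOpen W → ∀ e : Fin n → VField n M, (∀ i, e i ∈ smoothFields W) →
      (∀ y ∈ W, Orthonormal ℝ fun i => e i y) →
      ∀ i, IsSmoothFun (n := n) W fun x => inner ℝ (X x) (e i x)) : X ∈ smoothFields U := by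
  intro x hx
  obtain ⟨W, hW, hxW, hWU, e, he, ho⟩ := exists_orthonormalFrame (n := n) hU hx
  have h : X ∈ smoothFields W := smoothFields_congr
    (smoothFields_sum_smul (c := fun i y => inner ℝ (X y) (e i y)) (hX W hWU hW e he ho) he)
    fun y hy => eq_sum_inner_smul_of_orthonormal (ho y hy) (X y)
  exact (h.contMDiffAt (hW.mem_nhds hxW)).contMDiffWithinAt

/-- The components of a gradient in an orthonormal frame are the derivatives of the function along
the frame. -/
theorem grad_mem_smoothFields (hU : IsOpen U) {f : M → ℝ} (hf : IsSmoothFun (n := n) U f) :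
    grad (n := n) f ∈ smoothFields U := by
  refine mem_smoothFields_of_inner (n := n) hU fun W hWU hW e he _ i => ?_
  simp only [inner_grad]
  exact isSmoothFun_lieDeriv hW (hf.mono hWU) (he i)

theorem gramDual_mem_smoothFields {ι : Type*} [Fintype ι] [DecidableEq ι] (hU : IsOpen U)
    {F : ι → VField n M} (hF : ∀ i, F i ∈ smoothFields U)
    (hind : ∀ x ∈ U, LinearIndependent ℝ fun i => F i x) (i : ι) :
    (fun x => gramDual (fun j => F j x) i) ∈ smoothFields U := by
  refine mem_smoothFields_of_inner (n := n) hU fun W hWU hW e he _ a => ?_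
  simp only [inner_gramDual_eq_det]
  refine ContMDiffOn.mul (ContMDiffOn.inv₀ (IsSmoothFun.det fun b c => ?_) fun x hx => ?_)
    (IsSmoothFun.det fun b c => ?_)
  · exact (isSmoothFun_inner (hF b) (hF c)).mono hWU
  · exact Matrix.det_gram_ne_zero_iff_linearIndependent.mpr (hind x (hWU hx))
  · by_cases hb : b = i
    · subst hb
      simp only [Matrix.of_apply, Function.update_self]
      exact isSmoothFun_inner (he a) (smoothFields_mono hWU (hF c))
    · simp only [Matrix.of_apply, Function.update_of_ne hb]
      exact (isSmoothFun_inner (hF b) (hF c)).mono hWU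

/-- Every tangent vector extends to a smooth vector field. -/
theorem exists_smoothField_apply_eq [T2Space M] (x : M) (v : TangentSpace (𝓡 n) x) :
    ∃ Y ∈ smoothFields (n := n) (M := M) Set.univ, Y x = v := by
  obtain ⟨W, hW, hxW, -, e, he, ho⟩ := exists_orthonormalFrame (n := n) isOpen_univ (Set.mem_univ x)
  obtain ⟨χ, -, hχ⟩ := (SmoothBumpFunction.nhds_basis_tsupport (I := 𝓡 n) x).mem_iff.mp
    (hW.mem_nhds hxW)
  have hY : (fun y => ∑ i, inner ℝ v (e i x) • e i y) ∈ smoothFields (n := n) (M := M) W :=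
    smoothFields_sum_smul (c := fun i _ => inner ℝ v (e i x)) (fun i => contMDiffOn_const) he
  refine ⟨fun y => χ y • ∑ i, inner ℝ v (e i x) • e i y, ?_, ?_⟩
  · exact (ContMDiffOn.smul_section_of_tsupport χ.contMDiff.contMDiffOn hW hχ hY).contMDiffOn
  · dsimp only
    rw [χ.eq_one, one_smul, ← eq_sum_inner_smul_of_orthonormal (ho x hxW) v]

/-- A tangent vector orthogonal to the linearly independent fields `F` extends to a smooth
vector field orthogonal to `F`. -/
theorem exists_orthField_apply_eq [T2Space M] {ι : Type*} [Fintype ι] [DecidableEq ι]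
    (hU : IsOpen U) {F : ι → VField n M} (hF : ∀ i, F i ∈ smoothFields U)
    (hind : ∀ x ∈ U, LinearIndependent ℝ fun i => F i x) {x : M} {v : TangentSpace (𝓡 n) x}
    (hv : ∀ i, inner ℝ v (F i x) = 0) : ∃ Y ∈ orthFields U F, Y x = v := by
  obtain ⟨Y, hY, rfl⟩ := exists_smoothField_apply_eq x v
  have hYU := smoothFields_mono (Set.subset_univ U) hY
  refine ⟨Y - fun y => ∑ i, inner ℝ (Y y) (F i y) • gramDual (fun j => F j y) i,
    ⟨smoothFields_sub hYU (smoothFields_sum_smul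
      (c := fun i y => inner ℝ (Y y) (F i y)) (X := fun i y => gramDual (fun j => F j y) i)
      (fun i => isSmoothFun_inner hYU (hF i)) (gramDual_mem_smoothFields hU hF hind)),
      fun j y hy => ?_⟩, ?_⟩
  · rw [Pi.sub_apply, inner_sub_left, sum_inner]
    simp only [real_inner_smul_left]
    simp [inner_gramDual_self (hind y hy)]
  · simp [hv]

/-- Independent fields extend to a moving frame near a point `x`: a basis of the orthogonal
complement at `x` is extended with constant components in a smooth orthonormal frame, and
independence persists near `x` because the Gram determinant is continuous. The orthonormal frame also gives an
orientation. -/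
theorem exists_movingFrame_extension (hU : IsOpen U) {ι : Type*} [Fintype ι] [DecidableEq ι]
    {r : ℕ} (hr : Fintype.card ι + r = n)
    {F : ι → VField n M} (hF : ∀ i, F i ∈ smoothFields U) {x : M} (hx : x ∈ U)
    (hind : LinearIndependent ℝ fun i => F i x) :
    ∃ V : Set M, IsOpen V ∧ x ∈ V ∧ V ⊆ U ∧
      ∃ (Z : Fin r → VField n M) (ν : TopVectorField n M),
        IsMovingFrame V (Sum.elim F Z) ∧ IsSmoothUnitVolume V ν := by
  obtain ⟨W, hW, hxW, hWU, e, he, ho⟩ := exists_orthonormalFrame (n := n) hU hx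
  let K := (Submodule.span ℝ (Set.range fun i => F i x))ᗮ
  have hK : Module.finrank ℝ K = r := by
    have h := (Submodule.span ℝ (Set.range fun i => F i x)).finrank_add_finrank_orthogonal
    rw [finrank_span_eq_card hind, finrank_tangentSpace] at h
    change Fintype.card ι + Module.finrank ℝ K = n at h
    omega
  let w : Module.Basis (Fin r) ℝ K := (Module.finBasis ℝ K).reindex (finCongr hK)
  let Z : Fin r → VField n M := fun a y => ∑ i, inner ℝ (w a : TangentSpace (𝓡 n) x) (e i x) • e i y
  have hZx : ∀ a, Z a x = w a := fun a =>
    (eq_sum_inner_smul_of_orthonormal (ho x hxW) _).symm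
  have hs : ∀ i, Sum.elim F Z i ∈ smoothFields W := by
    rintro (i | a)
    · exact smoothFields_mono hWU (hF i)
    · -- the components of `w a` in the frame at `x` serve as constants on all of `W`
      exact smoothFields_sum_smul (c := fun i _ => inner ℝ (w a : TangentSpace (𝓡 n) x) (e i x))
        (fun i => contMDiffOn_const) he
  have hx0 : LinearIndependent ℝ fun i => Sum.elim F Z i x := by
    have h : (fun i => Sum.elim F Z i x)
        = Sum.elim (fun i => F i x) fun a => (w a : TangentSpace (𝓡 n) x) := by
      funext i
      rcases i with i | a
      · rfl
      · exact hZx a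
    rw [h]
    refine hind.sum_type (w.linearIndependent.map' K.subtype K.ker_subtype) ?_
    refine (Submodule.orthogonal_disjoint _).mono_right ?_
    rw [Submodule.span_le]
    rintro _ ⟨a, rfl⟩
    exact (w a).2
  have hdet : IsSmoothFun (n := n) W
      fun y => (Matrix.gram ℝ fun i => Sum.elim F Z i y).det :=
    IsSmoothFun.det fun i j => isSmoothFun_inner (hs i) (hs j)
  have hopen := hdet.continuousOn.isOpen_inter_preimage hW (isOpen_compl_singleton (x := (0 : ℝ)))
  refine ⟨_, hopen, ⟨hxW, ?_⟩, Set.inter_subset_left.trans hWU, Z,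
    fun y => wedgeAll fun i => e i y, ⟨fun i => smoothFields_mono Set.inter_subset_left (hs i),
      fun y hy => ?_⟩, fun y hy => ⟨_, hopen, hy, subset_rfl, e,
        fun i => smoothFields_mono Set.inter_subset_left (he i), fun z hz => ⟨ho z hz.1, rfl⟩⟩⟩
  · exact Matrix.det_gram_ne_zero_iff_linearIndependent.mpr hx0
  · have h : LinearIndependent ℝ fun i => Sum.elim F Z i y :=
      Matrix.det_gram_ne_zero_iff_linearIndependent.mp hy.2
    exact ⟨h, h.span_eq_top_of_card_eq_finrank' (by
      rw [finrank_tangentSpace, Fintype.card_sum, Fintype.card_fin, hr])⟩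

end Smooth

/-! ### The particular field and the generators -/

section Dissipative

variable {n : ℕ} {M : Type*} [TopologicalSpace M] [ChartedSpace (EuclideanSpace ℝ (Fin n)) M]
  [RiemannianBundle (fun x : M => TangentSpace (𝓡 n) x)]
  {k p : ℕ} {I : Fin k → M → ℝ} {D h : Fin p → M → ℝ}

/-- The gradients in the order `∇D₁, …, ∇D_p, ∇I₁, …, ∇I_k` in which they enter the wedge
products. -/
noncomputable def gradAppend (I : Fin k → M → ℝ) (D : Fin p → M → ℝ) : Fin (p + k) → VField n M :=
  fun a x => Fin.append (fun j => grad (D j) x) (fun l => grad (I l) x) a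

theorem gradAppend_castAdd (j : Fin p) (x : M) :
    gradAppend (n := n) I D (Fin.castAdd k j) x = gradFamily I D (Sum.inr j) x :=
  Fin.append_left _ _ j

theorem gradAppend_natAdd (l : Fin k) (x : M) :
    gradAppend (n := n) I D (Fin.natAdd p l) x = gradFamily I D (Sum.inl l) x :=
  Fin.append_right _ _ l

theorem wedgeDI_eq (x : M) :
    wedgeDI (n := n) I D x = wedgeAll fun a => gradAppend I D a x :=
  wedgeAll_mul_wedgeAll _ _

theorem linearIndependent_gradAppend {x : M}
    (hind : LinearIndependent ℝ fun i => gradFamily (n := n) I D i x) :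
    LinearIndependent ℝ fun a => gradAppend (n := n) I D a x := by
  have hφ : Function.Injective (Fin.append Sum.inr Sum.inl : Fin (p + k) → Fin k ⊕ Fin p) :=
    Fin.append_injective_iff.mpr ⟨Sum.inr_injective, Sum.inl_injective, fun _ _ => Sum.inr_ne_inl⟩
  convert hind.comp _ hφ using 1
  funext a
  refine Fin.addCases (fun j => ?_) (fun l => ?_) a <;> simp [gradAppend, gradFamily]

theorem linearIndependent_append_gradAppend {r : ℕ} {Z : Fin r → VField n M} {x : M}
    (hind : LinearIndependent ℝ fun i => Sum.elim (gradFamily (n := n) I D) Z i x) :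
    LinearIndependent ℝ (Fin.append (fun a => Z a x) fun a => gradAppend (n := n) I D a x) := by
  have hφ : Function.Injective
      (Fin.append Sum.inr (Sum.inl ∘ Fin.append Sum.inr Sum.inl) :
        Fin (r + (p + k)) → (Fin k ⊕ Fin p) ⊕ Fin r) :=
    Fin.append_injective_iff.mpr ⟨Sum.inr_injective, Sum.inl_injective.comp
      (Fin.append_injective_iff.mpr
        ⟨Sum.inr_injective, Sum.inl_injective, fun _ _ => Sum.inr_ne_inl⟩),
      fun _ _ => Sum.inr_ne_inl⟩
  convert hind.comp _ hφ using 1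
  funext a
  refine Fin.addCases (fun j => ?_) (fun b => ?_) a
  · simp
  · refine Fin.addCases (fun j => ?_) (fun l => ?_) b <;> simp [gradAppend, gradFamily]

theorem forall_inner_gradAppend_iff {x : M} (v : TangentSpace (𝓡 n) x) :
    (∀ a, inner ℝ v (gradAppend (n := n) I D a x) = 0)
      ↔ ∀ i, inner ℝ v (gradFamily (n := n) I D i x) = 0 := by
  constructor
  · rintro h (l | j)
    · exact gradAppend_natAdd (n := n) (D := D) l x ▸ h (Fin.natAdd p l)
    · exact gradAppend_castAdd (n := n) (I := I) j x ▸ h (Fin.castAdd k j)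
  · intro h a
    refine Fin.addCases (fun j => ?_) (fun l => ?_) a
    · exact (gradAppend_castAdd (n := n) j x).symm ▸ h (Sum.inr j)
    · exact (gradAppend_natAdd (n := n) l x).symm ▸ h (Sum.inl l)

/-- The particular solution is the combination of the vectors dual to the `∇D_i` with coefficients
`h_i`; in particular it does not depend on the choice of the unit `n`-vectors. -/
theorem particularField_eq (hkp : k + p ≤ n) {μ : TopVectorField n M} {x : M}
    (hμ : IsUnitVolume (μ x)) (hind : LinearIndependent ℝ fun i => gradFamily (n := n) I D i x) :
    particularField μ I D h x
      = ∑ i, h i x • gramDual (fun a => gradAppend (n := n) I D a x) (Fin.castAdd k i) := by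
  have hind' := linearIndependent_gradAppend hind
  have hdet := Matrix.det_gram_ne_zero_iff_linearIndependent.mpr hind'
  rw [particularField, wedgeDI_eq, normPow_wedgeAll_sq, Finset.smul_sum]
  refine Finset.sum_congr rfl fun i _ => ?_
  have hΘ : thetaField μ I D i x = ((-1 : ℝ) ^ (n - ((i : ℕ) + 1)) *
      (Matrix.gram ℝ fun a => gradAppend (n := n) I D a x).det) •
        gramDual (fun a => gradAppend (n := n) I D a x) (Fin.castAdd k i) :=
    hodgeStar_wedgeOmit_wedge_hodgeStar (by exact finrank_tangentSpace x) (by omega) hμ _ _ hind' i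
  have hs : (-1 : ℝ) ^ (n - ((i : ℕ) + 1)) * (-1 : ℝ) ^ (n - ((i : ℕ) + 1)) = 1 := by
    rw [← mul_pow]
    norm_num
  rw [hΘ, smul_smul, smul_smul]
  congr 1
  field_simp
  linear_combination (h i x) * hs

theorem inner_particularField (hkp : k + p ≤ n) {μ : TopVectorField n M} {x : M}
    (hμ : IsUnitVolume (μ x)) (hind : LinearIndependent ℝ fun i => gradFamily (n := n) I D i x)
    (i : Fin k ⊕ Fin p) :
    inner ℝ (particularField μ I D h x) (gradFamily I D i x)
      = Sum.elim (fun _ => 0) (fun j => h j x) i := by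
  have hind' := linearIndependent_gradAppend hind
  rw [particularField_eq hkp hμ hind, sum_inner]
  simp only [real_inner_smul_left]
  rcases i with l | j
  · rw [← gradAppend_natAdd]
    refine Finset.sum_eq_zero fun i _ => ?_
    rw [inner_gramDual_self hind', if_neg, mul_zero]
    intro h'
    have := congrArg Fin.val h'
    simp at this
    omega
  · rw [← gradAppend_castAdd]
    simp [inner_gramDual_self hind']

theorem generatorField_eq {r : ℕ} (ν : TopVectorField n M) (Z : Fin r → VField n M) (a : Fin r)
    (x : M) : generatorField ν Z I D a x = exteriorPower.oneEquiv ℝ (TangentSpace (𝓡 n) x)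
      (hodgeStar (ν x) 1 (wedgeOmit (fun i => Z i x) a ⋏
        wedgeAll fun a => gradAppend (n := n) I D a x)) := by
  rw [generatorField, wedgeDI_eq]

variable [IsManifold (𝓡 n) ∞ M] [IsContMDiffRiemannianBundle (𝓡 n) ∞ (EuclideanSpace ℝ (Fin n))
      (fun x : M => TangentSpace (𝓡 n) x)] {U : Set M}

theorem gradFamily_mem_smoothFields (hU : IsOpen U) (hI : ∀ l, IsSmoothFun (n := n) U (I l))
    (hD : ∀ j, IsSmoothFun (n := n) U (D j)) (i : Fin k ⊕ Fin p) :
    gradFamily (n := n) I D i ∈ smoothFields U := by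
  rcases i with l | j
  · exact grad_mem_smoothFields hU (hI l)
  · exact grad_mem_smoothFields hU (hD j)

theorem gradAppend_mem_smoothFields (hU : IsOpen U) (hI : ∀ l, IsSmoothFun (n := n) U (I l))
    (hD : ∀ j, IsSmoothFun (n := n) U (D j)) (a : Fin (p + k)) :
    gradAppend (n := n) I D a ∈ smoothFields U := by
  refine Fin.addCases (fun j => ?_) (fun l => ?_) a
  · refine smoothFields_congr (grad_mem_smoothFields hU (hD j)) fun x _ => ?_
    simp [gradAppend]
  · refine smoothFields_congr (grad_mem_smoothFields hU (hI l)) fun x _ => ?_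
    simp [gradAppend]

theorem particularField_mem_smoothFields (hkp : k + p ≤ n) (hU : IsOpen U)
    (hI : ∀ l, IsSmoothFun (n := n) U (I l)) (hD : ∀ j, IsSmoothFun (n := n) U (D j))
    (hh : ∀ j, IsSmoothFun (n := n) U (h j))
    (hind : ∀ x ∈ U, LinearIndependent ℝ fun i => gradFamily (n := n) I D i x)
    {μ : TopVectorField n M} (hμ : ∀ x ∈ U, IsUnitVolume (μ x)) :
    particularField μ I D h ∈ smoothFields U :=
  smoothFields_congr (smoothFields_sum_smul (c := h)
    (X := fun i x => gramDual (fun a => gradAppend (n := n) I D a x) (Fin.castAdd k i)) hh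
    fun i => gramDual_mem_smoothFields hU (gradAppend_mem_smoothFields hU hI hD)
      (fun x hx => linearIndependent_gradAppend (hind x hx)) (Fin.castAdd k i))
    fun x hx => particularField_eq hkp (hμ x hx) (hind x hx)

theorem generatorField_mem_smoothFields {r : ℕ} (hr : r + (p + k) = n) (hU : IsOpen U)
    (hI : ∀ l, IsSmoothFun (n := n) U (I l)) (hD : ∀ j, IsSmoothFun (n := n) U (D j))
    {Z : Fin r → VField n M} (hZ : ∀ a, Z a ∈ smoothFields U) {ν : TopVectorField n M}
    (hν : IsSmoothUnitVolume U ν) (a : Fin r) : generatorField ν Z I D a ∈ smoothFields U := by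
  intro x hx
  obtain ⟨W, hW, hxW, hWU, e, he, hoe⟩ := hν x hx
  have hs : ∀ c, (fun y => Fin.append (fun i => Z i y) (fun i => gradAppend (n := n) I D i y) c)
      ∈ smoothFields (n := n) U := by
    intro c
    refine Fin.addCases (fun i => ?_) (fun i => ?_) c
    · simpa using hZ i
    · simpa using gradAppend_mem_smoothFields hU hI hD i
  have h : generatorField ν Z I D a ∈ smoothFields W := by
    refine mem_smoothFields_of_inner (n := n) hW fun W' hW' _ e' he' _ i => ?_
    refine ContMDiffOn.congr (f := fun y => (-1 : ℝ) ^ (p + k + (r - 1 - (a : ℕ))) *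
        (Matrix.of fun b c => inner ℝ (e (Fin.cast hr b) y)
          (Function.update (Fin.append (fun i => Z i y) fun i => gradAppend (n := n) I D i y)
            (Fin.castAdd (p + k) a) (e' i y) c)).det) ?_ fun y hy => ?_
    · refine ContMDiffOn.mul contMDiffOn_const (IsSmoothFun.det fun b c => ?_)
      simp only [Matrix.of_apply]
      by_cases hc : c = Fin.castAdd (p + k) a
      · subst hc
        simp only [Function.update_self]
        exact isSmoothFun_inner (smoothFields_mono hW' (he _)) (he' i)
      · simp only [Function.update_of_ne hc]
        exact isSmoothFun_inner (smoothFields_mono hW' (he _))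
          (smoothFields_mono (hW'.trans hWU) (hs c))
    · obtain ⟨ho, hνy⟩ := hoe y (hW' hy)
      rw [generatorField_eq, hνy]
      exact inner_hodgeStar_wedgeOmit_eq_det (by exact finrank_tangentSpace y) hr ho _ _ a _
  exact (ContMDiffOn.contMDiffAt h (hW.mem_nhds hxW)).contMDiffWithinAt

end Dissipative

theorem theorem4p1 (n k p : ℕ) (hk : 0 < k) (hp : 1 < p) (hkp : k + p < n - 1)
    (M : Type*) [TopologicalSpace M] [T2Space M]
    [ChartedSpace (EuclideanSpace ℝ (Fin n)) M] [IsManifold (𝓡 n) ∞ M]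
    [RiemannianBundle (fun x : M => TangentSpace (𝓡 n) x)]
    [IsContMDiffRiemannianBundle (𝓡 n) ∞ (EuclideanSpace ℝ (Fin n))
      (fun x : M => TangentSpace (𝓡 n) x)]
    (U : Set M) (hU : IsOpen U)
    (I : Fin k → M → ℝ) (D h : Fin p → M → ℝ)
    (hI : ∀ l, IsSmoothFun (n := n) U (I l))
    (hD : ∀ j, IsSmoothFun (n := n) U (D j))
    (hh : ∀ j, IsSmoothFun (n := n) U (h j))
    (hind : ∀ x ∈ U, LinearIndependent ℝ fun i => gradFamily (n := n) I D i x)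
    (μ : TopVectorField n M) (hμ : ∀ x ∈ U, IsUnitVolume (μ x)) :
    let F : Fin k ⊕ Fin p → VField n M := gradFamily I D
    let X₀ : VField n M := particularField μ I D h
    let sol : Set (VField n M) :=
      {X | X ∈ smoothFields U ∧ (∀ l, Conserves U X (I l)) ∧ ∀ j, Dissipates U X (D j) (h j)}
    X₀ ∈ smoothFields U ∧
    sol = affineFields U X₀ F ∧
    (∀ X ∈ sol, IsDissipative U X) ∧
    IsSmoothAffineDistribution (n - (k + p)) U sol ∧
    (∀ x ∈ U, ∃ V : Set M, IsOpen V ∧ x ∈ V ∧ V ⊆ U ∧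
      ∃ (Z : Fin (n - (k + p)) → VField n M) (ν : TopVectorField n M),
        IsMovingFrame V (Sum.elim F Z) ∧ IsSmoothUnitVolume V ν) ∧
    ∀ (V : Set M) (Z : Fin (n - (k + p)) → VField n M) (ν : TopVectorField n M),
      IsOpen V → V ⊆ U → IsMovingFrame V (Sum.elim F Z) → IsSmoothUnitVolume V ν →
        IsLocalGenerators sol V X₀ (generatorField ν Z I D) := by
  intro F X₀ sol
  have hle : k + p ≤ n := by omega
  have hF : ∀ i, F i ∈ smoothFields U := gradFamily_mem_smoothFields hU hI hD
  have hX₀ : X₀ ∈ smoothFields U := particularField_mem_smoothFields hle hU hI hD hh hind hμ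
  have hX₀F : ∀ x ∈ U, ∀ i, inner ℝ (X₀ x) (F i x) = Sum.elim (fun _ => 0) (fun j => h j x) i :=
    fun x hx => inner_particularField hle (hμ x hx) (hind x hx)
  have hmem : ∀ X, X ∈ sol ↔ X ∈ smoothFields U ∧
      ∀ x ∈ U, ∀ i, inner ℝ (X x) (F i x) = inner ℝ (X₀ x) (F i x) := by
    intro X
    refine and_congr_right fun _ =>
      ⟨fun hX x hx i => ?_, fun hX => ⟨fun l x hx => ?_, fun j x hx => ?_⟩⟩
    · rw [hX₀F x hx, real_inner_comm]
      rcases i with l | j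
      · exact (lieDeriv_eq_inner_grad X (I l) x).symm.trans (hX.1 l x hx)
      · exact (lieDeriv_eq_inner_grad X (D j) x).symm.trans (hX.2 j x hx)
    · rw [lieDeriv_eq_inner_grad, real_inner_comm]
      exact (hX x hx (Sum.inl l)).trans (hX₀F x hx (Sum.inl l))
    · rw [lieDeriv_eq_inner_grad, real_inner_comm]
      exact (hX x hx (Sum.inr j)).trans (hX₀F x hx (Sum.inr j))
  have hsol : sol = affineFields U X₀ F := by
    ext X
    rw [hmem]
    constructor
    · rintro ⟨hX, hXF⟩
      refine ⟨X - X₀, ⟨smoothFields_sub hX hX₀, fun i x hx => ?_⟩, (add_sub_cancel X₀ X).symm⟩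
      rw [Pi.sub_apply, inner_sub_left, hXF x hx, sub_self]
    · rintro ⟨Y, ⟨hY, hYF⟩, rfl⟩
      refine ⟨smoothFields_add hX₀ hY, fun x hx i => ?_⟩
      rw [Pi.add_apply, inner_add_left, hYF i x hx, add_zero]
  -- the fibre of the solutions consists of all vectors with the prescribed products with `F`
  have hfib : ∀ x ∈ U, ∀ v, v ∈ fiberAt sol x ↔
      ∀ i, inner ℝ (v - X₀ x) (F i x) = 0 := by
    intro x hx v
    constructor
    · rintro ⟨X, hX, rfl⟩ i
      rw [inner_sub_left, ((hmem X).mp hX).2 x hx i, sub_self]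
    · intro hv
      obtain ⟨Y, hY, hYx⟩ := exists_orthField_apply_eq hU hF hind hv
      refine ⟨X₀ + Y, hsol ▸ ⟨Y, hY, rfl⟩, ?_⟩
      simp only [Pi.add_apply, hYx, add_sub_cancel]
  have hgen : ∀ (V : Set M) (Z : Fin (n - (k + p)) → VField n M) (ν : TopVectorField n M),
      IsOpen V → V ⊆ U → IsMovingFrame V (Sum.elim F Z) → IsSmoothUnitVolume V ν →
        IsLocalGenerators sol V X₀ (generatorField ν Z I D) := by
    intro V Z ν hV hVU hZ hν
    have hr : n - (k + p) + (p + k) = n := by omega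
    refine ⟨smoothFields_mono hVU hX₀, generatorField_mem_smoothFields hr hV
      (fun l => (hI l).mono hVU) (fun j => (hD j).mono hVU) (fun a => hZ.1 (Sum.inr a)) hν,
      fun x hx => ?_⟩
    have hνx : IsUnitVolume (ν x) := by
      obtain ⟨W, -, hxW, -, e, -, he⟩ := hν x hx
      exact ⟨_, (he x hxW).1, (he x hxW).2⟩
    have hli := linearIndependent_append_gradAppend (hZ.2 x hx).1
    simp only [generatorField_eq]
    refine ⟨linearIndependent_hodgeStar_wedgeOmit (by exact finrank_tangentSpace x) hr hνx _ _ hli,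
      Set.ext fun v => ?_⟩
    rw [hfib x (hVU hx), ← forall_inner_gradAppend_iff,
      ← mem_span_hodgeStar_wedgeOmit_iff (by exact finrank_tangentSpace x) hr hνx _ _ hli]
    constructor
    · exact fun hv => ⟨_, hv, (add_sub_cancel (X₀ x) v).symm⟩
    · rintro ⟨w, hw, rfl⟩
      rwa [add_sub_cancel_left]
  have hfrm : ∀ x ∈ U, ∃ V : Set M, IsOpen V ∧ x ∈ V ∧ V ⊆ U ∧
      ∃ (Z : Fin (n - (k + p)) → VField n M) (ν : TopVectorField n M),
        IsMovingFrame V (Sum.elim F Z) ∧ IsSmoothUnitVolume V ν := fun x hx =>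
    exists_movingFrame_extension hU
      (by rw [Fintype.card_sum, Fintype.card_fin, Fintype.card_fin]; omega) hF hx (hind x hx)
  refine ⟨hX₀, hsol, fun X hX => ⟨hX.1, k, p, I, D, h, by omega, hI, hD, hh, hX.2.1, hX.2.2⟩,
    ⟨fun x hx => ?_, fun X => ⟨fun hX => ⟨hX.1, fun x _ => ⟨X, hX, rfl⟩⟩, fun hX => ?_⟩⟩,
    hfrm, hgen⟩
  · obtain ⟨V, hV, hxV, hVU, Z, ν, hZ, hν⟩ := hfrm x hx
    exact ⟨V, hV, hxV, hVU, X₀, generatorField ν Z I D, hgen V Z ν hV hVU hZ hν⟩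
  · refine (hmem X).mpr ⟨hX.1, fun x hx i => ?_⟩
    have := (hfib x hx _).mp (hX.2 x hx) i
    rwa [inner_sub_left, sub_eq_zero] at this
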